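/- **Validity is invariant under one-step execution, in a model of the Android 6 permission system.** *States.* Fix sets of application, permission, permission-group, component, component-instance and intent identifiers, certificates, URIs, resources, values, API calls, etc., and a platform: an initial resource value, the manufacturer's certificate, a set of predefined system permissions, and the relation "permission $p$ is required for API call $sac$". A permission is (identifier, optional group, level), the level being dangerous, normal, signature or signature/system. A component is an activity, a service, a broadcast receiver or a content provider; each has an identifier, and a content provider maps URIs to resources. A manifest lists components, minimum and target SDK (optional), used permission identifiers, defined permissions and an optional protecting permission. A state $s$ consists of the set of user-installed applications; partial functions giving the permission groups, and the individual permissions, granted to each application; the running instances (partial function from instances to components); permanent and temporary delegations (partial functions from (application, provider, URI), resp. (instance, provider, URI), to $\{read, write, rw\}$); the values of resources (partial function from (application, resource)); the set of sent, unprocessed intents, each with the instance that sent it; the manifests, certificates and defined permissions of user-installed applications (partial functions); and the set of system-image applications, each with identifier, certificate, manifest and defined permissions. Partial functions are represented as sets of pairs. An application is *present* if it is user-installed or in the system image. *Validity.* $valid\_state(s)$ holds iff: (1) different components of present applications have different identifiers; (2) no component belongs to two applications; (3) no running instance is an instance of a content provider; (4) every temporary delegation is to a running instance and over a content provider of a present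 application; (5) every running component belongs to a present application; (6) every application with a resource value is present; (7) the domains of the manifest, certificate and defined-permission maps are exactly the user-installed applications; (8) the domains of the two granted-permission maps are exactly the present applications; (9) no user-installed application shares its identifier with a system application, and system applications have different identifiers; (10) all permissions defined by applications have different identifiers; (11) all nine partial functions are single-valued; (12) every individually granted permission is a system permission or is defined by a present application; (13) all sent intents have different identifiers. *Actions.* Each action $a$ has a precondition $Pre(s,a)$ and a postcondition $Post(s,a,s')$; state parts not mentioned do not change. - $install\ app\ m\ c\ lRes$: requires that $app$ is not present, that the components of $m$ have identifiers different from each other and from those in $s$, that the permissions it defines have identifiers different from each other and from those defined by present applications, and that its intent filters only name intent actions of the type that the component handles. Adds $app$, manifest $m$, certificate $c$, its defined permissions other than (those with the identifiers of) system permissions, its resources with the initial value, and empty sets of granted permissions and groups. - $uninstall\ app$: requires that $app$ is user-installed with no running component. Removes all records of $app$, the delegations to it and over its providers, and the permissions it defines from the individual grants of other applications. - $grant\ p\ app$ / $revoke\ p\ app$: grant requires that $app$ is present and uses $p$, and that $p$ exists, is dangerous, ungrouped and not yet granted; revoke requires that $p$ is granted. They add/remove $p$. - $grantPermGroup\ g\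 app$ / $revokePermGroup\ g\ app$: grant requires that $app$ is present, uses an existing dangerous permission of group $g$, and was not granted $g$; revoke requires that $g$ is granted. They add/remove $g$. - $hasPermission\ p\ app$, $read\ ic\ cp\ u$, $call\ ic\ sac$ leave the state unchanged; $read$ requires that $u$ belongs to the present provider $cp$ and that the running instance $ic$ may read it, $call$ that the application of the running $ic$ has all the permissions required for $sac$. $write\ ic\ cp\ u\ v$ requires the same as $read$, for writing, and sets the resource of $cp$ at $u$ to $v$. - $startActivity$, $startActivityRes$, $startService$, $sendBroadcast$, $sendOrdBroadcast$, $sendSBroadcast$: require a running instance $ic$ and an intent of the matching type, with no required permission set on it and with an identifier not already used by a sent intent; the intent (restricted to receivers with permission $p$, for the two broadcast actions that specify one) is added to the sent intents. - $resolveIntent\ i\ app$: requires that $i$ is a sent intent that names no component, and that some component of $app$ has an intent filter matching $i$ and may be started by the running sender. $i$ is replaced by a copy that names such a component. - $receiveIntent\ i\ ic\ app$: requires that $i$ was sent by the running $ic$, names a component of $app$ that handles its type and that $ic$ may start, that $app$ has the permission set on $i$, if any, and that if $i$ hands over a right on a URI then $ic$ can delegate it. $i$ is removed, a fresh instance of the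 named component runs, and the handed-over right is temporarily delegated to that instance. - $stop\ ic$: requires that $ic$ is running. Removes $ic$ and the temporary delegations to it. - $grantP\ ic\ cp\ app\ u\ pt$: requires that $app$ is present, that $u$ belongs to $cp$, that $cp$ allows delegation over $u$ and that the running $ic$ may itself perform $pt$. Adds $pt$ to the permanent delegation of $(app,cp,u)$. - $revokeDel\ ic\ cp\ u\ pt$: requires that $u$ belongs to $cp$ and that the running $ic$ may perform $pt$. Takes $pt$ away from all permanent and temporary delegations on $(cp,u)$. An application *has* a permission iff it declares it as used and either defines it itself, or the permission is normal, or dangerous and granted (through its group if it is grouped, individually if not), or signature(/system) with the application signed by the same certificate as its definer (the manufacturer for system permissions), or signature/system with the application signed by the manufacturer. An instance may start a component, or access a provider, of its own application; otherwise the component must be exported and the application of the instance must have the permission protecting it, if any; access to a provider may also come from a delegation. $ErrorMsg(s,a,ec)$ holds iff the error code $ec$ reports a way in which $Pre(s,a)$ fails in $s$. *Execution.* $s \xrightarrow{a/ok} s'$ holds iff $valid\_state(s)$, $Pre(s,a)$ and $Post(s,a,s')$; $s \xrightarrow{a/error(ec)} s'$ holds iff $valid\_state(s)$, $ErrorMsg(s,a,ec)$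 and $s'=s$. **Statement.** For all states $s,s'$, every action $a$ and every response $r$ ($ok$ or $error(ec)$): if $s \xrightarrow{a/r} s'$, then $valid\_state(s')$. -/

import Mathlib

universe u v

namespace Android

/-! # Vocabulary -/

/-- The abstract carrier types of the model (identifiers, certificates, URIs, and so on).
Nothing is assumed about them. -/
structure Vocabulary where
  AppId : Type u
  PermId : Type u
  PermGroup : Type u
  CompId : Type u
  IComp : Type u
  Cert : Type u
  Uri : Type u
  Res : Type u
  Val : Type u
  MimeType : Type u
  IntentId : Type u
  ActionName : Type u
  Category : Type u
  Extra : Type u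
  SACall : Type u

/-- Operations on resources: read, write, and both. -/
inductive OpTy where
  | read
  | write
  | rw

namespace OpTy

/-- `pt.Covers op`: a right `pt` includes the right `op`. -/
def Covers : OpTy → OpTy → Prop
  | rw, _ => True
  | read, read => True
  | write, write => True
  | _, _ => False

/-- The union of two rights. -/
def plus : OpTy → OpTy → OpTy
  | read, read => read
  | write, write => write
  | _, _ => rw

/-- What is left of the first right once the second one is taken away. -/
def minus : OpTy → OpTy → Option OpTy
  | _, rw => none
  | read, read => none
  | write, write => none
  | read, write => some read
  | write, read => some write
  | rw, read => some write
  | rw, write => some read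

end OpTy

inductive PermLvl where
  | dangerous
  | normal
  | signature
  | signatureOrSystem

structure Perm (V : Vocabulary.{u}) where
  id : V.PermId
  group : Option V.PermGroup
  level : PermLvl

/-! ## Intents and intent filters -/

inductive IntentType where
  | activity
  | service
  | broadcast

structure IntentAction (V : Vocabulary.{u}) where
  name : V.ActionName
  type : IntentType

inductive DataType where
  | content
  | file
  | other

structure IntentData (V : Vocabulary.{u}) where
  path : Option V.Uri
  mime : Option V.MimeType
  type : DataType

structure IntentFilter (V : Vocabulary.{u}) where
  actions : Set (IntentAction V)
  data : Set (IntentData V)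
  categories : Set V.Category

/-- An intent. It is explicit when `target` is present, and implicit otherwise. `grantFlag` is the
right on the URI of its data that the sender hands over to the receiver, if any; `brPerm` is the
permission that the receivers of a broadcast must have, if any. -/
structure Intent (V : Vocabulary.{u}) where
  id : V.IntentId
  target : Option V.CompId
  type : IntentType
  action : Option (IntentAction V)
  data : IntentData V
  categories : Set V.Category
  extra : Option V.Extra
  grantFlag : Option OpTy
  brPerm : Option (Perm V)

/-! ## Components, manifests, applications of the system image -/

/-- The data of an activity, a service or a broadcast receiver. -/
structure BasicComp (V : Vocabulary.{u}) where
  id : V.CompId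
  exported : Option Bool
  protectedBy : Option (Perm V)
  filters : Set (IntentFilter V)

/-- A content provider. `mapRes` maps the URIs assigned for external access to resources;
`grantUri` allows delegation for all of its URIs, `grantableUris` for the listed ones. -/
structure ContProv (V : Vocabulary.{u}) where
  id : V.CompId
  mapRes : V.Uri → Option V.Res
  exported : Option Bool
  protectedBy : Option (Perm V)
  readPerm : Option (Perm V)
  writePerm : Option (Perm V)
  grantUri : Bool
  grantableUris : Set V.Uri

inductive Comp (V : Vocabulary.{u}) where
  | activity (a : BasicComp V)
  | service (a : BasicComp V)
  | receiver (a : BasicComp V)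
  | provider (cp : ContProv V)

namespace Comp

variable {V : Vocabulary.{u}}

def id : Comp V → V.CompId
  | activity a => a.id
  | service a => a.id
  | receiver a => a.id
  | provider cp => cp.id

/-- The intent filters of a component; content providers have none. -/
def filters : Comp V → Set (IntentFilter V)
  | activity a => a.filters
  | service a => a.filters
  | receiver a => a.filters
  | provider _ => ∅

/-- The type of intents that a component handles; content providers handle none. -/
def Handles : Comp V → IntentType → Prop
  | activity _, .activity => True
  | service _, .service => True
  | receiver _, .broadcast => True
  | _, _ => False

def IsProvider : Comp V → Prop
  | provider _ => True
  | _ => False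

/-- The permission by which a component is protected. -/
def protectedBy : Comp V → Option (Perm V)
  | activity a => a.protectedBy
  | service a => a.protectedBy
  | receiver a => a.protectedBy
  | provider cp => cp.protectedBy

/-- The component declares itself as exported; an activity, a service or a receiver that does not
say so is exported iff it has an intent filter. -/
def IsExported : Comp V → Prop
  | activity a => a.exported = some true ∨ (a.exported = none ∧ a.filters.Nonempty)
  | service a => a.exported = some true ∨ (a.exported = none ∧ a.filters.Nonempty)
  | receiver a => a.exported = some true ∨ (a.exported = none ∧ a.filters.Nonempty)
  | provider cp => cp.exported = some true

/-- The intent filters of the component are well defined: the intent actions that they name are of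
the type of intents that the component handles. -/
def DeclaresIntentFiltersCorrectly (c : Comp V) : Prop :=
  ∀ f ∈ c.filters, ∀ act ∈ f.actions, c.Handles act.type

end Comp

structure Manifest (V : Vocabulary.{u}) where
  cmp : Set (Comp V)
  minSdk : Option ℕ
  targetSdk : Option ℕ
  uses : Set V.PermId
  usrP : Set (Perm V)
  appE : Option V.PermId

structure SysImgApp (V : Vocabulary.{u}) where
  id : V.AppId
  cert : V.Cert
  manifest : Manifest V
  defPerms : Set (Perm V)
  resources : List V.Res

/-- The fixed data of the platform: the initial value of resources, the certificate of the device
manufacturer, the permissions predefined by the system, and the permissions that are required for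
each API call. Nothing is assumed about them. -/
structure Platform (V : Vocabulary.{u}) where
  initVal : V.Val
  manufacturerCert : V.Cert
  systemPerms : Set (Perm V)
  permSAC : Perm V → V.SACall → Prop

/-! ## Partial functions as sets of pairs -/

/-- A set of pairs, meant as the graph of a partial function; that it really is one is a part of
the validity of states. -/
abbrev Mapping (K : Type u) (W : Type v) := Set (K × W)

namespace Mapping

variable {K : Type u} {W : Type v}

def dom (m : Mapping K W) : Set K := {k | ∃ w, (k, w) ∈ m}

def IsFunctional (m : Mapping K W) : Prop :=
  ∀ k w w', (k, w) ∈ m → (k, w') ∈ m → w = w'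

/-- Bind `k` to `w`, and forget any former value of `k`. -/
def add (m : Mapping K W) (k : K) (w : W) : Mapping K W :=
  {x | (x ∈ m ∧ x.1 ≠ k) ∨ x = (k, w)}

/-- Forget the values of the keys in `d`. -/
def drop (m : Mapping K W) (d : Set K) : Mapping K W := {x | x ∈ m ∧ x.1 ∉ d}

/-- Change every value with a function that may depend on the key. -/
def mapValues (m : Mapping K W) (f : K → W → W) : Mapping K W :=
  {x | ∃ w, (x.1, w) ∈ m ∧ x.2 = f x.1 w}

end Mapping

/-! # States -/

structure AndroidST (V : Vocabulary.{u}) where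
  /-- applications installed by the user -/
  instApps : Set V.AppId
  /-- permission groups granted to each application -/
  permsGr : Mapping V.AppId (Set V.PermGroup)
  /-- individual permissions granted to each application -/
  appPS : Mapping V.AppId (Set (Perm V))
  /-- running component instances -/
  running : Mapping V.IComp (Comp V)
  /-- permanent permission delegations -/
  delPPerms : Mapping (V.AppId × ContProv V × V.Uri) OpTy
  /-- temporary permission delegations -/
  delTPerms : Mapping (V.IComp × ContProv V × V.Uri) OpTy
  /-- values of the resources of applications -/
  arvs : Mapping (V.AppId × V.Res) V.Val
  /-- intents sent and not yet processed -/
  intents : Set (V.IComp × Intent V)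
  manifests : Mapping V.AppId (Manifest V)
  certs : Mapping V.AppId V.Cert
  /-- permissions defined by each application installed by the user -/
  appDefPS : Mapping V.AppId (Set (Perm V))
  sysImage : Set (SysImgApp V)

section Observers

variable {V : Vocabulary.{u}}

def IsSysApp (app : V.AppId) (s : AndroidST V) : Prop := ∃ sa ∈ s.sysImage, sa.id = app

/-- The application is present: installed by the user, or in the system image. -/
def IsAppInstalled (app : V.AppId) (s : AndroidST V) : Prop :=
  app ∈ s.instApps ∨ IsSysApp app s

def IsManifestOf (app : V.AppId) (m : Manifest V) (s : AndroidST V) : Prop :=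
  (app, m) ∈ s.manifests ∨ ∃ sa ∈ s.sysImage, sa.id = app ∧ sa.manifest = m

def IsCertOf (app : V.AppId) (c : V.Cert) (s : AndroidST V) : Prop :=
  (app, c) ∈ s.certs ∨ ∃ sa ∈ s.sysImage, sa.id = app ∧ sa.cert = c

/-- The component belongs to the application. -/
def InApp (c : Comp V) (app : V.AppId) (s : AndroidST V) : Prop :=
  ∃ m, IsManifestOf app m s ∧ c ∈ m.cmp

/-- The application defines the permission. -/
def DefinesPerm (app : V.AppId) (p : Perm V) (s : AndroidST V) : Prop :=
  (∃ l, (app, l) ∈ s.appDefPS ∧ p ∈ l) ∨ ∃ sa ∈ s.sysImage, sa.id = app ∧ p ∈ sa.defPerms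

/-- The permission is predefined by the system or defined by an application. -/
def PermExists (P : Platform V) (p : Perm V) (s : AndroidST V) : Prop :=
  p ∈ P.systemPerms ∨ ∃ app, DefinesPerm app p s

/-- The permission is declared by someone who signs with the certificate `c`: an application, or
the manufacturer in the case of predefined permissions. -/
def IsCertOfDefiner (P : Platform V) (p : Perm V) (c : V.Cert) (s : AndroidST V) : Prop :=
  (∃ app, DefinesPerm app p s ∧ IsCertOf app c s) ∨
    (p ∈ P.systemPerms ∧ c = P.manufacturerCert)

/-- The application is considered to have the permission: it declares it as used, and it defines
the permission itself, or the rule for the level of the permission is met. -/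
def AppHasPermission (P : Platform V) (app : V.AppId) (p : Perm V) (s : AndroidST V) : Prop :=
  (∃ m, IsManifestOf app m s ∧ p.id ∈ m.uses) ∧
    (DefinesPerm app p s ∨
      match p.level with
      | .normal => True
      | .dangerous =>
          match p.group with
          | some g => ∃ l, (app, l) ∈ s.permsGr ∧ g ∈ l
          | none => ∃ l, (app, l) ∈ s.appPS ∧ p ∈ l
      | .signature => ∃ c, IsCertOf app c s ∧ IsCertOfDefiner P p c s
      | .signatureOrSystem =>
          ∃ c, IsCertOf app c s ∧ (IsCertOfDefiner P p c s ∨ c = P.manufacturerCert))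

/-- Application `app` meets the protection of a component of application `owner`: the permission
`req` that protects the component or, if there is none, the one in the manifest of `owner`. -/
def MeetsProtection (P : Platform V) (app owner : V.AppId) (req : Option (Perm V))
    (s : AndroidST V) : Prop :=
  match req with
  | some p => AppHasPermission P app p s
  | none => ∀ m, IsManifestOf owner m s → ∀ pid, m.appE = some pid →
      ∃ p, p.id = pid ∧ PermExists P p s ∧ AppHasPermission P app p s

/-- The application that contains `c'` may create a new running instance of `c`. -/
def CanStart (P : Platform V) (c' c : Comp V) (s : AndroidST V) : Prop :=
  ∃ app' app, InApp c' app' s ∧ InApp c app s ∧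
    (app' = app ∨ (c.IsExported ∧ MeetsProtection P app' app c.protectedBy s))

/-- The URI `u` belongs to the content provider `cp`, which is present. -/
def ExistsRes (cp : ContProv V) (u : V.Uri) (s : AndroidST V) : Prop :=
  (∃ app, InApp (.provider cp) app s) ∧ ∃ r, cp.mapRes u = some r

/-- The content provider `cp` allows the delegation of permissions over the URI `u`. -/
def CanGrant (cp : ContProv V) (u : V.Uri) (s : AndroidST V) : Prop :=
  (∃ app, InApp (.provider cp) app s) ∧ (cp.grantUri = true ∨ u ∈ cp.grantableUris)

/-- A content provider of `owner` can be accessed by other applications: it is exported explicitly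
or, if it does not say, by default, which is the case when the minimum or the target version of
the SDK is at most 16. -/
def ProviderAccessible (cp : ContProv V) (owner : V.AppId) (s : AndroidST V) : Prop :=
  (Comp.provider cp).IsExported ∨
    (cp.exported = none ∧ ∃ m, IsManifestOf owner m s ∧
      ((∃ n, m.minSdk = some n ∧ n ≤ 16) ∨ ∃ n, m.targetSdk = some n ∧ n ≤ 16))

/-- The component `c` can access the content provider `cp` without delegation, where `req` is the
permission that `cp` requires specifically for the kind of access, if any. -/
def CanAccess (P : Platform V) (c : Comp V) (cp : ContProv V) (req : Option (Perm V))
    (s : AndroidST V) : Prop :=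
  ∃ app owner, InApp c app s ∧ InApp (.provider cp) owner s ∧
    (app = owner ∨ (ProviderAccessible cp owner s ∧
      MeetsProtection P app owner (req.or cp.protectedBy) s))

def CanRead (P : Platform V) (c : Comp V) (cp : ContProv V) (s : AndroidST V) : Prop :=
  CanAccess P c cp cp.readPerm s

def CanWrite (P : Platform V) (c : Comp V) (cp : ContProv V) (s : AndroidST V) : Prop :=
  CanAccess P c cp cp.writePerm s

/-- The right `op` was delegated to the running instance `ic` of `c`, or to its application. -/
def IsDelegated (ic : V.IComp) (c : Comp V) (cp : ContProv V) (u : V.Uri) (op : OpTy)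
    (s : AndroidST V) : Prop :=
  (∃ pt, ((ic, cp, u), pt) ∈ s.delTPerms ∧ pt.Covers op) ∨
    ∃ app pt, InApp c app s ∧ ((app, cp, u), pt) ∈ s.delPPerms ∧ pt.Covers op

/-- The instance `ic` of `c` may perform the operation on the URI `u` of `cp`, by its own right or
by delegation. -/
def MayOperate (P : Platform V) (ic : V.IComp) (c : Comp V) (cp : ContProv V) (u : V.Uri)
    (s : AndroidST V) : OpTy → Prop
  | .read => CanRead P c cp s ∨ IsDelegated ic c cp u .read s
  | .write => CanWrite P c cp s ∨ IsDelegated ic c cp u .write s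
  | .rw => (CanRead P c cp s ∨ IsDelegated ic c cp u .read s) ∧
      (CanWrite P c cp s ∨ IsDelegated ic c cp u .write s)

/-! ## Intent resolution -/

def ActionTest (i : Intent V) (f : IntentFilter V) : Prop :=
  match i.action with
  | some a => a ∈ f.actions
  | none => f.actions.Nonempty

def CategoryTest (i : Intent V) (f : IntentFilter V) : Prop := i.categories ⊆ f.categories

def DataTest (i : Intent V) (f : IntentFilter V) : Prop :=
  match i.data.path, i.data.mime with
  | none, none => f.data = ∅
  | some u, none => ∃ d ∈ f.data, d.path = some u ∧ d.mime = none
  | none, some t => ∃ d ∈ f.data, d.path = none ∧ d.mime = some t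
  | some u, some t => ∃ d ∈ f.data, d.mime = some t ∧
      (d.path = some u ∨ (d.path = none ∧ (i.data.type = .content ∨ i.data.type = .file)))

/-- The component can handle the implicit intent. -/
def Fits (i : Intent V) (c : Comp V) : Prop :=
  c.Handles i.type ∧ ∃ f ∈ c.filters, ActionTest i f ∧ CategoryTest i f ∧ DataTest i f

/-- The URI and the right on it that an intent hands over to its receiver, if any. -/
def Intent.delegation (i : Intent V) : Option (V.Uri × OpTy) :=
  match i.data.type, i.data.path, i.grantFlag with
  | .content, some u, some pt => some (u, pt)
  | _, _, _ => none

end Observers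

/-! # Valid states -/

structure ValidState {V : Vocabulary.{u}} (P : Platform V) (s : AndroidST V) : Prop where
  /-- all the components, of user and system applications, have different identifiers -/
  cmpDifferent : ∀ c c' app app', InApp c app s → InApp c' app' s → c.id = c'.id → c = c'
  /-- no component belongs to two different applications -/
  notRepeatedCmps : ∀ c app app', InApp c app s → InApp c app' s → app = app'
  /-- no running component is an instance of a content provider -/
  notProviderRunning : ∀ ic c, (ic, c) ∈ s.running → ¬ c.IsProvider
  /-- temporary delegations are to running components, over content providers that are present -/
  delTmpRun : ∀ ic cp uri pt, ((ic, cp, uri), pt) ∈ s.delTPerms →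
    (∃ c, (ic, c) ∈ s.running) ∧ ∃ app, InApp (.provider cp) app s
  /-- every running component belongs to an application that is present -/
  cmpRunAppIns : ∀ ic c, (ic, c) ∈ s.running → ∃ app, InApp c app s
  /-- every application that sets a value for a resource is present -/
  resAppIns : ∀ app r v, ((app, r), v) ∈ s.arvs → IsAppInstalled app s
  /-- domains of the partial functions on user installed applications -/
  manifestsDom : Mapping.dom s.manifests = s.instApps
  certsDom : Mapping.dom s.certs = s.instApps
  appDefPSDom : Mapping.dom s.appDefPS = s.instApps
  /-- domains of the partial functions on all the applications -/
  appPSDom : Mapping.dom s.appPS = {app | IsAppInstalled app s}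
  permsGrDom : Mapping.dom s.permsGr = {app | IsAppInstalled app s}
  /-- installed applications are distinct from the system ones, which differ from each other -/
  notDupApp : ∀ app ∈ s.instApps, ¬ IsSysApp app s
  notDupSysApp : ∀ sa ∈ s.sysImage, ∀ sa' ∈ s.sysImage, sa.id = sa'.id → sa = sa'
  /-- all the permissions defined by applications have different identifiers -/
  notDupPerm : ∀ app app' p p', DefinesPerm app p s → DefinesPerm app' p' s → p.id = p'.id →
    p = p' ∧ app = app'
  /-- every partial function is a function -/
  permsGrFun : Mapping.IsFunctional s.permsGr
  appPSFun : Mapping.IsFunctional s.appPS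
  runningFun : Mapping.IsFunctional s.running
  delPPermsFun : Mapping.IsFunctional s.delPPerms
  delTPermsFun : Mapping.IsFunctional s.delTPerms
  arvsFun : Mapping.IsFunctional s.arvs
  manifestsFun : Mapping.IsFunctional s.manifests
  certsFun : Mapping.IsFunctional s.certs
  appDefPSFun : Mapping.IsFunctional s.appDefPS
  /-- every individually granted permission exists -/
  grantedPermsExist : ∀ app l p, (app, l) ∈ s.appPS → p ∈ l → PermExists P p s
  /-- all the sent intents have different identifiers -/
  notDupIntents : ∀ ic ic' i i', (ic, i) ∈ s.intents → (ic', i') ∈ s.intents → i.id = i'.id →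
    ic = ic' ∧ i = i'

/-! # Actions -/

/-- The permission of a broadcast is optional, `none` standing for no restriction. -/
inductive Action (V : Vocabulary.{u}) where
  | install (app : V.AppId) (m : Manifest V) (c : V.Cert) (lRes : List V.Res)
  | uninstall (app : V.AppId)
  | grant (p : Perm V) (app : V.AppId)
  | revoke (p : Perm V) (app : V.AppId)
  | grantPermGroup (g : V.PermGroup) (app : V.AppId)
  | revokePermGroup (g : V.PermGroup) (app : V.AppId)
  | hasPermission (p : Perm V) (app : V.AppId)
  | read (ic : V.IComp) (cp : ContProv V) (uri : V.Uri)
  | write (ic : V.IComp) (cp : ContProv V) (uri : V.Uri) (val : V.Val)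
  | startActivity (i : Intent V) (ic : V.IComp)
  | startActivityRes (i : Intent V) (n : ℕ) (ic : V.IComp)
  | startService (i : Intent V) (ic : V.IComp)
  | sendBroadcast (i : Intent V) (ic : V.IComp) (p : Option (Perm V))
  | sendOrdBroadcast (i : Intent V) (ic : V.IComp) (p : Option (Perm V))
  | sendSBroadcast (i : Intent V) (ic : V.IComp)
  | resolveIntent (i : Intent V) (app : V.AppId)
  | receiveIntent (i : Intent V) (ic : V.IComp) (app : V.AppId)
  | stopInstance (ic : V.IComp)
  | grantP (ic : V.IComp) (cp : ContProv V) (app : V.AppId) (uri : V.Uri) (pt : OpTy)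
  | revokeDel (ic : V.IComp) (cp : ContProv V) (uri : V.Uri) (pt : OpTy)
  | call (ic : V.IComp) (sac : V.SACall)

inductive ErrorCode where
  | appAlreadyInstalled
  | duplicatedCmpId
  | duplicatedPermId
  | cmpAlreadyDefined
  | permAlreadyDefined
  | faultyIntentFilter
  | noSuchApp
  | appIsRunning
  | permNotInUse
  | noSuchPerm
  | permAlreadyGranted
  | permNotDangerous
  | permIsGrouped
  | permWasntGranted
  | groupNotInUse
  | groupAlreadyGranted
  | groupWasntGranted
  | instanceNotRunning
  | noSuchRes
  | notEnoughPermissions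
  | incorrectIntentType
  | faultyIntent
  | intentAlreadySent
  | noSuchIntent
  | noComponentFits
  | cannotBeStarted
  | providerNotGrantable
  | noProviderFits

/-! ## Conditions that occur in the preconditions -/

section Conditions

variable {V : Vocabulary.{u}}

def HasDuplicatesCmp (m : Manifest V) : Prop :=
  ∃ c ∈ m.cmp, ∃ c' ∈ m.cmp, c ≠ c' ∧ c.id = c'.id

def HasDuplicatesPerm (m : Manifest V) : Prop :=
  ∃ p ∈ m.usrP, ∃ p' ∈ m.usrP, p ≠ p' ∧ p.id = p'.id

/-- The identifier of `c` is that of a component present in the device. -/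
def CmpInState (c : Comp V) (s : AndroidST V) : Prop :=
  ∃ c' app, InApp c' app s ∧ c'.id = c.id

/-- The permissions defined in the manifest differ from those defined by other applications. -/
def AuthPerms (m : Manifest V) (s : AndroidST V) : Prop :=
  ∀ p ∈ m.usrP, ∀ app p', DefinesPerm app p' s → p'.id ≠ p.id

/-- The permissions defined in the manifest that are not system permissions. -/
def nonSystemUsrP (P : Platform V) (m : Manifest V) : Set (Perm V) :=
  {p | p ∈ m.usrP ∧ ∀ q ∈ P.systemPerms, q.id ≠ p.id}

/-- No component of the application is running. -/
def NotRunning (app : V.AppId) (s : AndroidST V) : Prop :=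
  ∀ ic c, (ic, c) ∈ s.running → ¬ InApp c app s

def UsesPerm (app : V.AppId) (p : Perm V) (s : AndroidST V) : Prop :=
  ∃ m, IsManifestOf app m s ∧ p.id ∈ m.uses

/-- The application declares as used a dangerous permission of the group. -/
def UsesGroup (P : Platform V) (app : V.AppId) (g : V.PermGroup) (s : AndroidST V) : Prop :=
  ∃ p, UsesPerm app p s ∧ PermExists P p s ∧ p.level = .dangerous ∧ p.group = some g

def PermGranted (app : V.AppId) (p : Perm V) (s : AndroidST V) : Prop :=
  ∃ l, (app, l) ∈ s.appPS ∧ p ∈ l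

def GroupGranted (app : V.AppId) (g : V.PermGroup) (s : AndroidST V) : Prop :=
  ∃ l, (app, l) ∈ s.permsGr ∧ g ∈ l

def InstanceRunning (ic : V.IComp) (s : AndroidST V) : Prop := ∃ c, (ic, c) ∈ s.running

/-- The running instance `ic` may perform the operation. -/
def InstanceMayOperate (P : Platform V) (ic : V.IComp) (cp : ContProv V) (uri : V.Uri) (op : OpTy)
    (s : AndroidST V) : Prop :=
  ∃ c, (ic, c) ∈ s.running ∧ MayOperate P ic c cp uri s op

/-- No unprocessed intent has the identifier of `i`. -/
def IntentFresh (i : Intent V) (s : AndroidST V) : Prop :=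
  ∀ ic i', (ic, i') ∈ s.intents → i'.id ≠ i.id

/-- Precondition common to the actions by which `ic` sends an intent of type `t`. -/
def PreSend (t : IntentType) (i : Intent V) (ic : V.IComp) (s : AndroidST V) : Prop :=
  i.type = t ∧ i.brPerm = none ∧ InstanceRunning ic s ∧ IntentFresh i s

/-- The implicit intent `i`, sent by `ic`, can be resolved to the component `c` of `app`. -/
def ResolvesTo (P : Platform V) (i : Intent V) (ic : V.IComp) (c : Comp V) (app : V.AppId)
    (s : AndroidST V) : Prop :=
  InApp c app s ∧ Fits i c ∧ ∃ c', (ic, c') ∈ s.running ∧ CanStart P c' c s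

/-- The component `c` of `app` is the one that the intent `i` names, and it handles such intents. -/
def IsTarget (i : Intent V) (c : Comp V) (app : V.AppId) (s : AndroidST V) : Prop :=
  InApp c app s ∧ i.target = some c.id ∧ c.Handles i.type

/-- The instance `ic` can delegate the right `pt` on the URI `uri` of `cp`. -/
def CanDelegate (P : Platform V) (ic : V.IComp) (cp : ContProv V) (uri : V.Uri) (pt : OpTy)
    (s : AndroidST V) : Prop :=
  ExistsRes cp uri s ∧ CanGrant cp uri s ∧ InstanceMayOperate P ic cp uri pt s

/-- The rights that the intent hands over, if any, can be delegated by its sender. -/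
def DelegationAllowed (P : Platform V) (i : Intent V) (ic : V.IComp) (s : AndroidST V) : Prop :=
  ∀ uri pt, i.delegation = some (uri, pt) → ∃ cp, CanDelegate P ic cp uri pt s

/-- The application of the running instance `ic` has all the permissions that the call requires. -/
def MayCall (P : Platform V) (ic : V.IComp) (sac : V.SACall) (s : AndroidST V) : Prop :=
  ∃ c app, (ic, c) ∈ s.running ∧ InApp c app s ∧
    ∀ p, P.permSAC p sac → AppHasPermission P app p s

end Conditions

/-! ## Preconditions -/

def Pre {V : Vocabulary.{u}} (P : Platform V) (s : AndroidST V) : Action V → Prop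
  | .install app m _ _ =>
      ¬ IsAppInstalled app s ∧ ¬ HasDuplicatesCmp m ∧ (∀ c ∈ m.cmp, ¬ CmpInState c s) ∧
        ¬ HasDuplicatesPerm m ∧ AuthPerms m s ∧ ∀ c ∈ m.cmp, c.DeclaresIntentFiltersCorrectly
  | .uninstall app => app ∈ s.instApps ∧ NotRunning app s
  | .grant p app =>
      IsAppInstalled app s ∧ UsesPerm app p s ∧ PermExists P p s ∧ ¬ PermGranted app p s ∧
        p.level = .dangerous ∧ p.group = none
  | .revoke p app => PermGranted app p s
  | .grantPermGroup g app =>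
      IsAppInstalled app s ∧ UsesGroup P app g s ∧ ¬ GroupGranted app g s
  | .revokePermGroup g app => GroupGranted app g s
  | .hasPermission _ _ => True
  | .read ic cp uri => ExistsRes cp uri s ∧ InstanceMayOperate P ic cp uri .read s
  | .write ic cp uri _ => ExistsRes cp uri s ∧ InstanceMayOperate P ic cp uri .write s
  | .startActivity i ic => PreSend .activity i ic s
  | .startActivityRes i _ ic => PreSend .activity i ic s
  | .startService i ic => PreSend .service i ic s
  | .sendBroadcast i ic _ => PreSend .broadcast i ic s
  | .sendOrdBroadcast i ic _ => PreSend .broadcast i ic s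
  | .sendSBroadcast i ic => PreSend .broadcast i ic s
  | .resolveIntent i app =>
      i.target = none ∧ ∃ ic c, (ic, i) ∈ s.intents ∧ ResolvesTo P i ic c app s
  | .receiveIntent i ic app =>
      (ic, i) ∈ s.intents ∧
        (∃ c c', IsTarget i c app s ∧ (ic, c') ∈ s.running ∧ CanStart P c' c s) ∧
        (∀ p, i.brPerm = some p → AppHasPermission P app p s) ∧ DelegationAllowed P i ic s
  | .stopInstance ic => InstanceRunning ic s
  | .grantP ic cp app uri pt => IsAppInstalled app s ∧ CanDelegate P ic cp uri pt s
  | .revokeDel ic cp uri pt => ExistsRes cp uri s ∧ InstanceMayOperate P ic cp uri pt s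
  | .call ic sac => MayCall P ic sac s

/-! ## Postconditions -/

section Effects

variable {V : Vocabulary.{u}}

def AddManifest (m : Manifest V) (app : V.AppId) (s s' : AndroidST V) : Prop :=
  s'.manifests = Mapping.add s.manifests app m

def AddCert (c : V.Cert) (app : V.AppId) (s s' : AndroidST V) : Prop :=
  s'.certs = Mapping.add s.certs app c

def AddDefPerms (P : Platform V) (app : V.AppId) (m : Manifest V) (s s' : AndroidST V) : Prop :=
  s'.appDefPS = Mapping.add s.appDefPS app (nonSystemUsrP P m)

def AddApp (app : V.AppId) (s s' : AndroidST V) : Prop := s'.instApps = insert app s.instApps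

def AddRes (P : Platform V) (app : V.AppId) (lRes : List V.Res) (s s' : AndroidST V) : Prop :=
  s'.arvs = {x | (x ∈ s.arvs ∧ ¬ (x.1.1 = app ∧ x.1.2 ∈ lRes)) ∨
    ∃ r ∈ lRes, x = ((app, r), P.initVal)}

def InitializePermLists (app : V.AppId) (s s' : AndroidST V) : Prop :=
  s'.appPS = Mapping.add s.appPS app ∅ ∧ s'.permsGr = Mapping.add s.permsGr app ∅

def SameOtherFieldsInstall (s s' : AndroidST V) : Prop :=
  s'.running = s.running ∧ s'.delPPerms = s.delPPerms ∧ s'.delTPerms = s.delTPerms ∧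
    s'.intents = s.intents ∧ s'.sysImage = s.sysImage

/-- Delegations once the right `pt` is added for the key `k`, on top of what `k` already has. -/
def addDelegation {K : Type u} (d : Mapping K OpTy) (k : K) (pt : OpTy) : Mapping K OpTy :=
  {x | (x ∈ d ∧ x.1 ≠ k) ∨ (x.1 = k ∧
    ((∃ old, (k, old) ∈ d ∧ x.2 = old.plus pt) ∨ ((∀ old, (k, old) ∉ d) ∧ x.2 = pt)))}

/-- Delegations once the right `pt` on the URI `uri` of `cp` is taken away from everyone. -/
def dropDelegations {K : Type u} (d : Mapping (K × ContProv V × V.Uri) OpTy)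
    (cp : ContProv V) (uri : V.Uri) (pt : OpTy) : Mapping (K × ContProv V × V.Uri) OpTy :=
  {x | (x ∈ d ∧ x.1.2 ≠ (cp, uri)) ∨
    (x.1.2 = (cp, uri) ∧ ∃ old, (x.1, old) ∈ d ∧ old.minus pt = some x.2)}

/-- The application and all that is recorded about it disappear, and so do the
delegations over its content providers; the permissions that it defined are taken away from the
other applications. -/
def PostUninstall (app : V.AppId) (s s' : AndroidST V) : Prop :=
  s' = { s with
    instApps := s.instApps \ {app}
    permsGr := Mapping.drop s.permsGr {app}
    appPS := Mapping.mapValues (Mapping.drop s.appPS {app})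
      fun _ l => {p | p ∈ l ∧ ¬ DefinesPerm app p s}
    delPPerms := {x | x ∈ s.delPPerms ∧ x.1.1 ≠ app ∧ ¬ InApp (.provider x.1.2.1) app s}
    delTPerms := {x | x ∈ s.delTPerms ∧ ¬ InApp (.provider x.1.2.1) app s}
    arvs := Mapping.drop s.arvs {k | k.1 = app}
    manifests := Mapping.drop s.manifests {app}
    certs := Mapping.drop s.certs {app}
    appDefPS := Mapping.drop s.appDefPS {app} }

/-- The resource of `cp` at `uri` gets the value `val`; nothing else changes. -/
def PostWrite (cp : ContProv V) (uri : V.Uri) (val : V.Val) (s s' : AndroidST V) : Prop :=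
  ∃ app r, InApp (.provider cp) app s ∧ cp.mapRes uri = some r ∧
    s' = { s with arvs := Mapping.add s.arvs (app, r) val }

/-- The intent, restricted to receivers with the permission `p` if any, is sent by `ic`. -/
def PostSend (i : Intent V) (ic : V.IComp) (p : Option (Perm V)) (s s' : AndroidST V) : Prop :=
  s' = { s with intents := insert (ic, { i with brPerm := p }) s.intents }

/-- The implicit intent is replaced by an explicit one, which names a component of `app`. -/
def PostResolve (P : Platform V) (i : Intent V) (app : V.AppId) (s s' : AndroidST V) : Prop :=
  ∃ ic c, (ic, i) ∈ s.intents ∧ ResolvesTo P i ic c app s ∧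
    s' = { s with
      intents := insert (ic, { i with target := some c.id }) (s.intents \ {(ic, i)}) }

/-- A fresh instance of the target component starts to run, the intent is consumed, and the rights
that it hands over are delegated temporarily to the new instance. -/
def PostReceive (P : Platform V) (i : Intent V) (ic : V.IComp) (app : V.AppId)
    (s s' : AndroidST V) : Prop :=
  ∃ ic' c d, ¬ InstanceRunning ic' s ∧ InApp c app s ∧ i.target = some c.id ∧
    (match i.delegation with
      | none => d = s.delTPerms
      | some (uri, pt) => ∃ cp, CanDelegate P ic cp uri pt s ∧
          d = addDelegation s.delTPerms (ic', cp, uri) pt) ∧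
    s' = { s with
      running := Mapping.add s.running ic' c
      delTPerms := d
      intents := s.intents \ {(ic, i)} }

end Effects

def Post {V : Vocabulary.{u}} (P : Platform V) (s : AndroidST V) (a : Action V)
    (s' : AndroidST V) : Prop :=
  match a with
  | .install app m c lRes =>
      AddManifest m app s s' ∧ AddCert c app s s' ∧ AddDefPerms P app m s s' ∧ AddApp app s s' ∧
        AddRes P app lRes s s' ∧ InitializePermLists app s s' ∧ SameOtherFieldsInstall s s'
  | .uninstall app => PostUninstall app s s'
  | .grant p app =>
      s' = { s with
        appPS := Mapping.mapValues s.appPS fun a l => {q | q ∈ l ∨ (a = app ∧ q = p)} }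
  | .revoke p app =>
      s' = { s with
        appPS := Mapping.mapValues s.appPS fun a l => {q | q ∈ l ∧ ¬ (a = app ∧ q = p)} }
  | .grantPermGroup g app =>
      s' = { s with
        permsGr := Mapping.mapValues s.permsGr fun a l => {h | h ∈ l ∨ (a = app ∧ h = g)} }
  | .revokePermGroup g app =>
      s' = { s with
        permsGr := Mapping.mapValues s.permsGr fun a l => {h | h ∈ l ∧ ¬ (a = app ∧ h = g)} }
  | .hasPermission _ _ => s' = s
  | .read _ _ _ => s' = s
  | .write _ cp uri val => PostWrite cp uri val s s'
  | .startActivity i ic => PostSend i ic none s s'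
  | .startActivityRes i _ ic => PostSend i ic none s s'
  | .startService i ic => PostSend i ic none s s'
  | .sendBroadcast i ic p => PostSend i ic p s s'
  | .sendOrdBroadcast i ic p => PostSend i ic p s s'
  | .sendSBroadcast i ic => PostSend i ic none s s'
  | .resolveIntent i app => PostResolve P i app s s'
  | .receiveIntent i ic app => PostReceive P i ic app s s'
  | .stopInstance ic =>
      s' = { s with
        running := Mapping.drop s.running {ic}
        delTPerms := {x | x ∈ s.delTPerms ∧ x.1.1 ≠ ic} }
  | .grantP _ cp app uri pt =>
      s' = { s with delPPerms := addDelegation s.delPPerms (app, cp, uri) pt }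
  | .revokeDel _ cp uri pt =>
      s' = { s with
        delPPerms := dropDelegations s.delPPerms cp uri pt
        delTPerms := dropDelegations s.delTPerms cp uri pt }
  | .call _ _ => s' = s

/-! ## Acceptable error responses -/

section Errors

variable {V : Vocabulary.{u}}

/-- Errors common to the actions by which an intent of type `t` is sent. -/
def SendError (t : IntentType) (i : Intent V) (ic : V.IComp) (s : AndroidST V) :
    ErrorCode → Prop
  | .incorrectIntentType => i.type ≠ t
  | .faultyIntent => i.brPerm ≠ none
  | .instanceNotRunning => ¬ InstanceRunning ic s
  | .intentAlreadySent => ¬ IntentFresh i s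
  | _ => False

/-- Errors common to the actions by which the instance `ic` performs `op` on a URI of `cp`. -/
def OperateError (P : Platform V) (ic : V.IComp) (cp : ContProv V) (uri : V.Uri) (op : OpTy)
    (s : AndroidST V) : ErrorCode → Prop
  | .noSuchRes => ¬ ExistsRes cp uri s
  | .instanceNotRunning => ¬ InstanceRunning ic s
  | .notEnoughPermissions => InstanceRunning ic s ∧ ¬ InstanceMayOperate P ic cp uri op s
  | _ => False

end Errors

/-- `ErrorMsg P s a ec`: the error `ec` is an acceptable response to the request of `a` in `s`.
Each error reports one of the ways in which the precondition of the action may fail. -/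
def ErrorMsg {V : Vocabulary.{u}} (P : Platform V) (s : AndroidST V) (a : Action V)
    (ec : ErrorCode) : Prop :=
  match a with
  | .install app m _ _ =>
      match ec with
      | .appAlreadyInstalled => IsAppInstalled app s
      | .duplicatedCmpId => HasDuplicatesCmp m
      | .duplicatedPermId => HasDuplicatesPerm m
      | .cmpAlreadyDefined => ∃ c ∈ m.cmp, CmpInState c s
      | .permAlreadyDefined => ¬ AuthPerms m s
      | .faultyIntentFilter => ∃ c ∈ m.cmp, ¬ c.DeclaresIntentFiltersCorrectly
      | _ => False
  | .uninstall app =>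
      match ec with
      | .noSuchApp => app ∉ s.instApps
      | .appIsRunning => ¬ NotRunning app s
      | _ => False
  | .grant p app =>
      match ec with
      | .noSuchApp => ¬ IsAppInstalled app s
      | .permNotInUse => ¬ UsesPerm app p s
      | .noSuchPerm => ¬ PermExists P p s
      | .permAlreadyGranted => PermGranted app p s
      | .permNotDangerous => p.level ≠ .dangerous
      | .permIsGrouped => p.group ≠ none
      | _ => False
  | .revoke p app =>
      match ec with
      | .permWasntGranted => ¬ PermGranted app p s
      | _ => False
  | .grantPermGroup g app =>
      match ec with
      | .noSuchApp => ¬ IsAppInstalled app s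
      | .groupNotInUse => ¬ UsesGroup P app g s
      | .groupAlreadyGranted => GroupGranted app g s
      | _ => False
  | .revokePermGroup g app =>
      match ec with
      | .groupWasntGranted => ¬ GroupGranted app g s
      | _ => False
  | .hasPermission _ _ => False
  | .read ic cp uri => OperateError P ic cp uri .read s ec
  | .write ic cp uri _ => OperateError P ic cp uri .write s ec
  | .startActivity i ic => SendError .activity i ic s ec
  | .startActivityRes i _ ic => SendError .activity i ic s ec
  | .startService i ic => SendError .service i ic s ec
  | .sendBroadcast i ic _ => SendError .broadcast i ic s ec
  | .sendOrdBroadcast i ic _ => SendError .broadcast i ic s ec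
  | .sendSBroadcast i ic => SendError .broadcast i ic s ec
  | .resolveIntent i app =>
      match ec with
      | .faultyIntent => i.target ≠ none
      | .noSuchIntent => ∀ ic, (ic, i) ∉ s.intents
      | .noComponentFits => ∃ ic, (ic, i) ∈ s.intents ∧ ∀ c, ¬ ResolvesTo P i ic c app s
      | _ => False
  | .receiveIntent i ic app =>
      match ec with
      | .noSuchIntent => (ic, i) ∉ s.intents
      | .noComponentFits => ∀ c, ¬ IsTarget i c app s
      | .instanceNotRunning => ¬ InstanceRunning ic s
      | .cannotBeStarted =>
          ∃ c c', IsTarget i c app s ∧ (ic, c') ∈ s.running ∧ ¬ CanStart P c' c s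
      | .notEnoughPermissions => ∃ p, i.brPerm = some p ∧ ¬ AppHasPermission P app p s
      | .noProviderFits => ¬ DelegationAllowed P i ic s
      | _ => False
  | .stopInstance ic =>
      match ec with
      | .instanceNotRunning => ¬ InstanceRunning ic s
      | _ => False
  | .grantP ic cp app uri pt =>
      match ec with
      | .noSuchApp => ¬ IsAppInstalled app s
      | .providerNotGrantable => ¬ CanGrant cp uri s
      | ec => OperateError P ic cp uri pt s ec
  | .revokeDel ic cp uri pt => OperateError P ic cp uri pt s ec
  | .call ic sac =>
      match ec with
      | .instanceNotRunning => ¬ InstanceRunning ic s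
      | .notEnoughPermissions => InstanceRunning ic s ∧ ¬ MayCall P ic sac s
      | _ => False

/-! # Executions -/

inductive Response where
  | ok
  | error (ec : ErrorCode)

/-- `Step P s a r s'`: the execution of the action `a` in the valid state `s` gives the response `r`
and the state `s'`. -/
inductive Step {V : Vocabulary.{u}} (P : Platform V) :
    AndroidST V → Action V → Response → AndroidST V → Prop
  | ok {s : AndroidST V} {a : Action V} {s' : AndroidST V} :
      ValidState P s → Pre P s a → Post P s a s' → Step P s a Response.ok s'
  | error {s : AndroidST V} {a : Action V} {ec : ErrorCode} :
      ValidState P s → ErrorMsg P s a ec → Step P s a (Response.error ec) s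

end Android

/-!
An error response leaves the state unchanged, so only the postconditions of the actions matter.
Most actions touch one or two parts of the state, by operations that keep graphs of partial
functions functional and whose domains are known, and the clauses of validity about all other parts
carry over verbatim. Four actions need an argument:

* `install`: the new application is not present, so its components and permissions are exactly those
  of the new manifest (`inApp_install`, `definesPerm_install`), and the precondition separates their
  identifiers from each other and from the old ones.
* `uninstall`: a user application is not a system one, so what belongs to the remaining applications
  is exactly what belonged to applications other than the removed one (`inApp_uninstall`,
  `definesPerm_uninstall`). No running component is lost, and neither is a provider with a
  remaining temporary delegation or the definer of a remaining granted permission.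
* `resolveIntent`: the new intent takes over the identifier of the one that it replaces, which no
  other sent intent has.
* `receiveIntent`: the postcondition only says that the new instance runs the component that the
  intent names. Identifiers determine components, so this is the component of the precondition,
  which handles intents and hence is no provider.
-/

namespace Android

/-! ### Partial functions -/

namespace Mapping

universe w

variable {K : Type u} {W : Type w} {m m' : Mapping K W}

theorem IsFunctional.mono (h : IsFunctional m) (hs : m' ⊆ m) : IsFunctional m' :=
  fun k v v' hv hv' => h k v v' (hs hv) (hs hv')

theorem IsFunctional.add (h : IsFunctional m) (k : K) (v : W) : IsFunctional (add m k v) := by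
  rintro a x y (⟨hx, hxa⟩ | hx) (⟨hy, hya⟩ | hy)
  · exact h a x y hx hy
  · exact absurd (Prod.ext_iff.1 hy).1 hxa
  · exact absurd (Prod.ext_iff.1 hx).1 hya
  · exact (Prod.ext_iff.1 hx).2.trans (Prod.ext_iff.1 hy).2.symm

theorem drop_subset (m : Mapping K W) (d : Set K) : drop m d ⊆ m := fun _ hx => hx.1

theorem mem_mapValues_iff {f : K → W → W} {a : K} {x : W} :
    (a, x) ∈ mapValues m f ↔ ∃ v, (a, v) ∈ m ∧ x = f a v :=
  Iff.rfl

theorem IsFunctional.mapValues (h : IsFunctional m) (f : K → W → W) :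
    IsFunctional (mapValues m f) := by
  intro a v v' hv hv'
  obtain ⟨x, hx, rfl⟩ := mem_mapValues_iff.1 hv
  obtain ⟨y, hy, rfl⟩ := mem_mapValues_iff.1 hv'
  exact congrArg (f a) (h a x y hx hy)

theorem dom_add (m : Mapping K W) (k : K) (v : W) : dom (add m k v) = insert k (dom m) := by
  ext a
  constructor
  · rintro ⟨x, ⟨hx, -⟩ | hx⟩
    · exact Or.inr ⟨x, hx⟩
    · exact Or.inl (Prod.ext_iff.1 hx).1
  · intro ha
    by_cases hak : a = k
    · exact ⟨v, Or.inr (by rw [hak])⟩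
    · obtain ⟨x, hx⟩ := ha.resolve_left hak
      exact ⟨x, Or.inl ⟨hx, hak⟩⟩

theorem dom_drop (m : Mapping K W) (d : Set K) : dom (drop m d) = dom m \ d := by
  ext a
  exact ⟨fun ⟨x, hx, ha⟩ => ⟨⟨x, hx⟩, ha⟩, fun ⟨⟨x, hx⟩, ha⟩ => ⟨x, hx, ha⟩⟩

theorem dom_mapValues (m : Mapping K W) (f : K → W → W) : dom (mapValues m f) = dom m := by
  ext a
  exact ⟨fun ⟨_, x, hx, _⟩ => ⟨x, hx⟩, fun ⟨x, hx⟩ => ⟨f a x, x, hx, rfl⟩⟩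

/-- Under a fresh key, `add` yields just the new value. -/
theorem mem_add_iff {k a : K} {v x : W} (hk : k ∉ dom m) :
    (a, x) ∈ add m k v ↔ (a, x) ∈ m ∨ (a = k ∧ x = v) := by
  constructor
  · rintro (⟨hx, -⟩ | hx)
    · exact Or.inl hx
    · exact Or.inr (Prod.ext_iff.1 hx)
  · rintro (hx | ⟨rfl, rfl⟩)
    · exact Or.inl ⟨hx, fun hak : a = k => hk ⟨x, hak ▸ hx⟩⟩
    · exact Or.inr rfl

end Mapping

theorem isFunctional_addDelegation {K : Type u} {d : Mapping K OpTy} (h : Mapping.IsFunctional d)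
    (k : K) (pt : OpTy) : Mapping.IsFunctional (addDelegation d k pt) := by
  rintro a x y (⟨hx, hxa⟩ | ⟨hxa, hx⟩) (⟨hy, hya⟩ | ⟨hya, hy⟩)
  · exact h a x y hx hy
  · exact absurd hya hxa
  · exact absurd hxa hya
  · rcases hx with ⟨o, ho, rfl⟩ | ⟨hn, rfl⟩ <;> rcases hy with ⟨o', ho', rfl⟩ | ⟨hn', rfl⟩
    · rw [h k o o' ho ho']
    · exact absurd ho (hn' o)
    · exact absurd ho' (hn o')
    · rfl

section

variable {V : Vocabulary.{u}} {P : Platform V} {s : AndroidST V}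

/-- Taking rights away creates no new keys. -/
theorem exists_mem_of_mem_dropDelegations {K : Type u} {d : Mapping (K × ContProv V × V.Uri) OpTy}
    {cp : ContProv V} {uri : V.Uri} {pt x : OpTy} {k : K × ContProv V × V.Uri}
    (h : (k, x) ∈ dropDelegations d cp uri pt) : ∃ old, (k, old) ∈ d := by
  rcases h with ⟨hx, -⟩ | ⟨-, old, ho, -⟩
  · exact ⟨x, hx⟩
  · exact ⟨old, ho⟩

theorem isFunctional_dropDelegations {K : Type u} {d : Mapping (K × ContProv V × V.Uri) OpTy}
    (h : Mapping.IsFunctional d) (cp : ContProv V) (uri : V.Uri) (pt : OpTy) :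
    Mapping.IsFunctional (dropDelegations d cp uri pt) := by
  rintro a x y (⟨hx, hxa⟩ | ⟨hxa, o, ho, hx⟩) (⟨hy, hya⟩ | ⟨hya, o', ho', hy⟩)
  · exact h a x y hx hy
  · exact absurd hya hxa
  · exact absurd hxa hya
  · rw [h a o o' ho ho'] at hx
    exact Option.some_injective _ (hx.symm.trans hy)

/-! ### Presence of the applications on record -/

theorem ValidState.isAppInstalled_of_isManifestOf (h : ValidState P s) {app : V.AppId}
    {m : Manifest V} (hm : IsManifestOf app m s) : IsAppInstalled app s := by
  rcases hm with hm | ⟨sa, hsa, hid, -⟩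
  · exact Or.inl (h.manifestsDom ▸ ⟨m, hm⟩)
  · exact Or.inr ⟨sa, hsa, hid⟩

theorem ValidState.isAppInstalled_of_inApp (h : ValidState P s) {app : V.AppId} {c : Comp V}
    (hc : InApp c app s) : IsAppInstalled app s :=
  let ⟨_, hm, _⟩ := hc
  h.isAppInstalled_of_isManifestOf hm

/-! ### Granting and revoking permissions and groups -/

/-- Changing the granted groups of applications preserves validity. -/
theorem ValidState.mapValues_permsGr (h : ValidState P s)
    (f : V.AppId → Set V.PermGroup → Set V.PermGroup) :
    ValidState P { s with permsGr := Mapping.mapValues s.permsGr f } :=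
  { h with
    permsGrDom := (Mapping.dom_mapValues _ _).trans h.permsGrDom
    permsGrFun := h.permsGrFun.mapValues f }

/-- Changing the granted permissions of applications preserves validity if every permission
that is new exists. -/
theorem ValidState.mapValues_appPS (h : ValidState P s)
    (f : V.AppId → Set (Perm V) → Set (Perm V))
    (hf : ∀ app l, ∀ p ∈ f app l, p ∈ l ∨ PermExists P p s) :
    ValidState P { s with appPS := Mapping.mapValues s.appPS f } :=
  { h with
    appPSDom := (Mapping.dom_mapValues _ _).trans h.appPSDom
    appPSFun := h.appPSFun.mapValues f
    grantedPermsExist := by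
      intro app l' p hl' hp
      obtain ⟨l, hl, rfl⟩ := Mapping.mem_mapValues_iff.1 hl'
      exact (hf app l p hp).elim (h.grantedPermsExist app l p hl) id }

/-! ### Resources, delegations, and running instances -/

theorem ValidState.postWrite (h : ValidState P s) {cp : ContProv V} {uri : V.Uri} {val : V.Val}
    {s' : AndroidST V} (hp : PostWrite cp uri val s s') : ValidState P s' := by
  obtain ⟨app, r, hin, -, rfl⟩ := hp
  exact { h with
    resAppIns := by
      rintro a r' v (⟨hx, -⟩ | hx)
      · exact h.resAppIns a r' v hx
      · cases hx
        exact h.isAppInstalled_of_inApp hin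
    arvsFun := h.arvsFun.add _ _ }

theorem ValidState.addDelegation_delPPerms (h : ValidState P s)
    (k : V.AppId × ContProv V × V.Uri) (pt : OpTy) :
    ValidState P { s with delPPerms := addDelegation s.delPPerms k pt } :=
  { h with delPPermsFun := isFunctional_addDelegation h.delPPermsFun k pt }

theorem ValidState.dropDelegations (h : ValidState P s) (cp : ContProv V) (uri : V.Uri)
    (pt : OpTy) :
    ValidState P { s with
      delPPerms := dropDelegations s.delPPerms cp uri pt
      delTPerms := Android.dropDelegations s.delTPerms cp uri pt } :=
  { h with
    delPPermsFun := isFunctional_dropDelegations h.delPPermsFun cp uri pt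
    delTPermsFun := isFunctional_dropDelegations h.delTPermsFun cp uri pt
    delTmpRun := fun ic cp' u _ hx =>
      let ⟨old, ho⟩ := exists_mem_of_mem_dropDelegations hx
      h.delTmpRun ic cp' u old ho }

theorem ValidState.stopInstance (h : ValidState P s) (ic : V.IComp) :
    ValidState P { s with
      running := Mapping.drop s.running {ic}
      delTPerms := {x | x ∈ s.delTPerms ∧ x.1.1 ≠ ic} } :=
  { h with
    notProviderRunning := fun ic' c hc => h.notProviderRunning ic' c hc.1
    delTmpRun := fun ic' cp u pt hx =>
      let ⟨⟨c, hc⟩, hp⟩ := h.delTmpRun ic' cp u pt hx.1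
      ⟨⟨c, hc, hx.2⟩, hp⟩
    cmpRunAppIns := fun ic' c hc => h.cmpRunAppIns ic' c hc.1
    runningFun := h.runningFun.mono (Mapping.drop_subset _ _)
    delTPermsFun := h.delTPermsFun.mono fun _ hx => hx.1 }

/-! ### Intents -/

theorem ValidState.postSend (h : ValidState P s) {i : Intent V} {ic : V.IComp}
    {p : Option (Perm V)} (hi : IntentFresh i s) {s' : AndroidST V} (hp : PostSend i ic p s s') :
    ValidState P s' := by
  cases hp
  exact { h with
    notDupIntents := by
      rintro ic₁ ic₂ i₁ i₂ (h₁ | h₁) (h₂ | h₂) hid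
      · cases h₁
        cases h₂
        exact ⟨rfl, rfl⟩
      · cases h₁
        exact absurd hid.symm (hi ic₂ i₂ h₂)
      · cases h₂
        exact absurd hid (hi ic₁ i₁ h₁)
      · exact h.notDupIntents ic₁ ic₂ i₁ i₂ h₁ h₂ hid }

theorem ValidState.postResolve (h : ValidState P s) {i : Intent V} {app : V.AppId}
    {s' : AndroidST V} (hp : PostResolve P i app s s') : ValidState P s' := by
  obtain ⟨ic, c, hi, -, rfl⟩ := hp
  have key : ∀ ic' i', (ic', i') ∈ s.intents \ {(ic, i)} → i'.id ≠ i.id := by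
    rintro ic' i' ⟨hm, hne⟩ hid
    obtain ⟨rfl, rfl⟩ := h.notDupIntents ic' ic i' i hm hi hid
    exact hne rfl
  exact { h with
    notDupIntents := by
      rintro ic₁ ic₂ i₁ i₂ (h₁ | h₁) (h₂ | h₂) hid
      · cases h₁
        cases h₂
        exact ⟨rfl, rfl⟩
      · cases h₁
        exact absurd hid.symm (key ic₂ i₂ h₂)
      · cases h₂
        exact absurd hid (key ic₁ i₁ h₁)
      · exact h.notDupIntents ic₁ ic₂ i₁ i₂ h₁.1 h₂.1 hid }

theorem Comp.Handles.not_isProvider {c : Comp V} {t : IntentType} (h : c.Handles t) :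
    ¬ c.IsProvider := by
  cases c <;> simp_all [Comp.Handles, Comp.IsProvider]

theorem ValidState.postReceive (h : ValidState P s) {i : Intent V} {ic : V.IComp} {app : V.AppId}
    (ht : ∃ c, IsTarget i c app s) {s' : AndroidST V} (hp : PostReceive P i ic app s s') :
    ValidState P s' := by
  obtain ⟨ic', c, d, hfresh, hin, htc, hd, rfl⟩ := hp
  obtain ⟨c₀, hin₀, htc₀, hh⟩ := ht
  obtain rfl : c = c₀ :=
    h.cmpDifferent _ _ _ _ hin hin₀ (Option.some_injective _ (htc.symm.trans htc₀))
  have hdFun : Mapping.IsFunctional d := by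
    split at hd
    · exact hd ▸ h.delTPermsFun
    · obtain ⟨cp, -, rfl⟩ := hd
      exact isFunctional_addDelegation h.delTPermsFun _ _
  -- The delegations in `d` are old ones, or go to the new instance.
  have hdMem : ∀ ic₁ cp u pt, ((ic₁, cp, u), pt) ∈ d →
      ((∃ c, (ic₁, c) ∈ s.running) ∨ ic₁ = ic') ∧ ∃ app, InApp (.provider cp) app s := by
    intro ic₁ cp u pt hx
    split at hd
    · subst hd
      exact (h.delTmpRun ic₁ cp u pt hx).imp_left Or.inl
    · obtain ⟨cp', hcan, rfl⟩ := hd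
      rcases hx with ⟨hx, -⟩ | ⟨hx, -⟩
      · exact (h.delTmpRun ic₁ cp u pt hx).imp_left Or.inl
      · cases hx
        exact ⟨Or.inr rfl, hcan.1.1⟩
  have hadd : ∀ ic₁ c₁, (ic₁, c₁) ∈ Mapping.add s.running ic' c ↔
      (ic₁, c₁) ∈ s.running ∨ (ic₁ = ic' ∧ c₁ = c) :=
    fun _ _ => Mapping.mem_add_iff hfresh
  exact { h with
    notProviderRunning := by
      intro ic₁ c₁ h₁
      rcases (hadd ic₁ c₁).1 h₁ with h₁ | ⟨-, rfl⟩
      · exact h.notProviderRunning ic₁ c₁ h₁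
      · exact hh.not_isProvider
    delTmpRun := by
      intro ic₁ cp u pt hx
      obtain ⟨⟨c₁, hc₁⟩ | rfl, happ⟩ := hdMem ic₁ cp u pt hx
      · exact ⟨⟨c₁, (hadd _ _).2 (Or.inl hc₁)⟩, happ⟩
      · exact ⟨⟨c, (hadd _ _).2 (Or.inr ⟨rfl, rfl⟩)⟩, happ⟩
    cmpRunAppIns := by
      intro ic₁ c₁ h₁
      rcases (hadd ic₁ c₁).1 h₁ with h₁ | ⟨-, rfl⟩
      · exact h.cmpRunAppIns ic₁ c₁ h₁
      · exact ⟨app, hin⟩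
    runningFun := h.runningFun.add _ _
    delTPermsFun := hdFun
    notDupIntents := fun ic₁ ic₂ i₁ i₂ h₁ h₂ => h.notDupIntents ic₁ ic₂ i₁ i₂ h₁.1 h₂.1 }

/-! ### Uninstalling an application -/

/-- Once an application that is not a system one is uninstalled, the others keep their components,
and it has none. -/
theorem inApp_uninstall {app : V.AppId} {s' : AndroidST V} (hsys : ¬ IsSysApp app s)
    (hp : PostUninstall app s s') {c : Comp V} {a : V.AppId} :
    InApp c a s' ↔ InApp c a s ∧ a ≠ app := by
  cases hp
  constructor
  · rintro ⟨m, ⟨hm, hne⟩ | ⟨sa, hsa, hid, rfl⟩, hc⟩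
    · exact ⟨⟨m, Or.inl hm, hc⟩, hne⟩
    · exact ⟨⟨_, Or.inr ⟨sa, hsa, hid, rfl⟩, hc⟩, fun hne => hsys ⟨sa, hsa, hid.trans hne⟩⟩
  · rintro ⟨⟨m, hm | hm, hc⟩, hne⟩
    · exact ⟨m, Or.inl ⟨hm, hne⟩, hc⟩
    · exact ⟨m, Or.inr hm, hc⟩

/-- Once an application that is not a system one is uninstalled, the others keep the permissions
that they define, and it defines none. -/
theorem definesPerm_uninstall {app : V.AppId} {s' : AndroidST V} (hsys : ¬ IsSysApp app s)
    (hp : PostUninstall app s s') {p : Perm V} {a : V.AppId} :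
    DefinesPerm a p s' ↔ DefinesPerm a p s ∧ a ≠ app := by
  cases hp
  constructor
  · rintro (⟨l, ⟨hl, hne⟩, hpl⟩ | ⟨sa, hsa, hid, hpl⟩)
    · exact ⟨Or.inl ⟨l, hl, hpl⟩, hne⟩
    · exact ⟨Or.inr ⟨sa, hsa, hid, hpl⟩, fun hne => hsys ⟨sa, hsa, hid.trans hne⟩⟩
  · rintro ⟨⟨l, hl, hpl⟩ | hd, hne⟩
    · exact Or.inl ⟨l, ⟨hl, hne⟩, hpl⟩
    · exact Or.inr hd

theorem isAppInstalled_uninstall {app : V.AppId} {s' : AndroidST V} (hsys : ¬ IsSysApp app s)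
    (hp : PostUninstall app s s') {a : V.AppId} :
    IsAppInstalled a s' ↔ IsAppInstalled a s ∧ a ≠ app := by
  cases hp
  constructor
  · rintro (⟨ha, hne⟩ | ha)
    · exact ⟨Or.inl ha, hne⟩
    · exact ⟨Or.inr ha, fun hne => hsys (hne ▸ ha)⟩
  · rintro ⟨ha | ha, hne⟩
    · exact Or.inl ⟨ha, hne⟩
    · exact Or.inr ha

theorem ValidState.postUninstall (h : ValidState P s) {app : V.AppId}
    (happ : app ∈ s.instApps) (hrun : NotRunning app s) {s' : AndroidST V}
    (hp : PostUninstall app s s') : ValidState P s' := by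
  have hsys := h.notDupApp app happ
  have inApp_iff := @inApp_uninstall V s app s' hsys hp
  have defines_iff := @definesPerm_uninstall V s app s' hsys hp
  have inst_iff := @isAppInstalled_uninstall V s app s' hsys hp
  have hdom : {a | IsAppInstalled a s} \ {app} = {a | IsAppInstalled a s'} :=
    Set.ext fun _ => inst_iff.symm
  cases hp
  let f : V.AppId → Set (Perm V) → Set (Perm V) := fun _ l => {p | p ∈ l ∧ ¬ DefinesPerm app p s}
  exact {
    cmpDifferent := fun c c' a a' hc hc' =>
      h.cmpDifferent c c' a a' (inApp_iff.1 hc).1 (inApp_iff.1 hc').1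
    notRepeatedCmps := fun c a a' hc hc' =>
      h.notRepeatedCmps c a a' (inApp_iff.1 hc).1 (inApp_iff.1 hc').1
    notProviderRunning := h.notProviderRunning
    delTmpRun := by
      rintro ic cp u pt ⟨hx, hn⟩
      obtain ⟨hc, a, ha⟩ := h.delTmpRun ic cp u pt hx
      exact ⟨hc, a, inApp_iff.2 ⟨ha, fun hne => hn (hne ▸ ha)⟩⟩
    cmpRunAppIns := by
      intro ic c hc
      obtain ⟨a, ha⟩ := h.cmpRunAppIns ic c hc
      exact ⟨a, inApp_iff.2 ⟨ha, fun hne => hrun ic c hc (hne ▸ ha)⟩⟩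
    resAppIns := fun a r v hx => inst_iff.2 ⟨h.resAppIns a r v hx.1, hx.2⟩
    manifestsDom := (Mapping.dom_drop _ _).trans (congrArg (· \ {app}) h.manifestsDom)
    certsDom := (Mapping.dom_drop _ _).trans (congrArg (· \ {app}) h.certsDom)
    appDefPSDom := (Mapping.dom_drop _ _).trans (congrArg (· \ {app}) h.appDefPSDom)
    appPSDom := (Mapping.dom_mapValues _ f).trans <|
      (Mapping.dom_drop _ _).trans ((congrArg (· \ {app}) h.appPSDom).trans hdom)
    permsGrDom := (Mapping.dom_drop _ _).trans ((congrArg (· \ {app}) h.permsGrDom).trans hdom)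
    notDupApp := fun a ha => h.notDupApp a ha.1
    notDupSysApp := h.notDupSysApp
    notDupPerm := fun a a' p p' hd hd' =>
      h.notDupPerm a a' p p' (defines_iff.1 hd).1 (defines_iff.1 hd').1
    permsGrFun := h.permsGrFun.mono (Mapping.drop_subset _ _)
    appPSFun := (h.appPSFun.mono (Mapping.drop_subset _ _)).mapValues f
    runningFun := h.runningFun
    delPPermsFun := h.delPPermsFun.mono fun _ hx => hx.1
    delTPermsFun := h.delTPermsFun.mono fun _ hx => hx.1
    arvsFun := h.arvsFun.mono (Mapping.drop_subset _ _)
    manifestsFun := h.manifestsFun.mono (Mapping.drop_subset _ _)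
    certsFun := h.certsFun.mono (Mapping.drop_subset _ _)
    appDefPSFun := h.appDefPSFun.mono (Mapping.drop_subset _ _)
    grantedPermsExist := by
      intro a l' p hl' hp
      obtain ⟨l, ⟨hl, -⟩, rfl⟩ := (Mapping.mem_mapValues_iff (f := f)).1 hl'
      obtain ⟨hpl, hnd⟩ := hp
      rcases h.grantedPermsExist a l p hl hpl with hsp | ⟨b, hb⟩
      · exact Or.inl hsp
      · exact Or.inr ⟨b, defines_iff.2 ⟨hb, fun hne => hnd (hne ▸ hb)⟩⟩
    notDupIntents := h.notDupIntents }

/-! ### Installing an application -/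

theorem inApp_install {app : V.AppId} {m : Manifest V} {s' : AndroidST V}
    (hdom : app ∉ Mapping.dom s.manifests) (hm : AddManifest m app s s')
    (hsys : s'.sysImage = s.sysImage) {c : Comp V} {a : V.AppId} :
    InApp c a s' ↔ InApp c a s ∨ (a = app ∧ c ∈ m.cmp) := by
  unfold AddManifest at hm
  simp only [InApp, IsManifestOf, hm, hsys, Mapping.mem_add_iff hdom]
  constructor
  · rintro ⟨m', (hm' | ⟨rfl, rfl⟩) | hm', hc⟩
    · exact Or.inl ⟨m', Or.inl hm', hc⟩
    · exact Or.inr ⟨rfl, hc⟩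
    · exact Or.inl ⟨m', Or.inr hm', hc⟩
  · rintro (⟨m', hm' | hm', hc⟩ | ⟨rfl, hc⟩)
    · exact ⟨m', Or.inl (Or.inl hm'), hc⟩
    · exact ⟨m', Or.inr hm', hc⟩
    · exact ⟨m, Or.inl (Or.inr ⟨rfl, rfl⟩), hc⟩

theorem definesPerm_install {app : V.AppId} {m : Manifest V} {s' : AndroidST V}
    (hdom : app ∉ Mapping.dom s.appDefPS) (hd : AddDefPerms P app m s s')
    (hsys : s'.sysImage = s.sysImage) {p : Perm V} {a : V.AppId} :
    DefinesPerm a p s' ↔ DefinesPerm a p s ∨ (a = app ∧ p ∈ nonSystemUsrP P m) := by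
  unfold AddDefPerms at hd
  simp only [DefinesPerm, hd, hsys, Mapping.mem_add_iff hdom]
  constructor
  · rintro (⟨l, hl | ⟨rfl, rfl⟩, hp⟩ | hs)
    · exact Or.inl (Or.inl ⟨l, hl, hp⟩)
    · exact Or.inr ⟨rfl, hp⟩
    · exact Or.inl (Or.inr hs)
  · rintro ((⟨l, hl, hp⟩ | hs) | ⟨rfl, hp⟩)
    · exact Or.inl ⟨l, Or.inl hl, hp⟩
    · exact Or.inr hs
    · exact Or.inl ⟨_, Or.inr ⟨rfl, rfl⟩, hp⟩

theorem isAppInstalled_install {app : V.AppId} {s' : AndroidST V} (ha : AddApp app s s')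
    (hsys : s'.sysImage = s.sysImage) {a : V.AppId} :
    IsAppInstalled a s' ↔ a = app ∨ IsAppInstalled a s := by
  unfold AddApp at ha
  simp only [IsAppInstalled, IsSysApp, ha, hsys, Set.mem_insert_iff, or_assoc]

/-- The given resources of one application are set all to the same value, so listing a resource
twice does no harm. -/
theorem isFunctional_addRes {app : V.AppId} {lRes : List V.Res} {s' : AndroidST V}
    (h : Mapping.IsFunctional s.arvs) (hr : AddRes P app lRes s s') :
    Mapping.IsFunctional s'.arvs := by
  rw [hr]
  rintro ⟨a, r⟩ v v' (⟨hv, hn⟩ | ⟨q, hq, hv⟩) (⟨hv', hn'⟩ | ⟨q', hq', hv'⟩)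
  · exact h _ v v' hv hv'
  · cases hv'
    exact absurd ⟨rfl, hq'⟩ hn
  · cases hv
    exact absurd ⟨rfl, hq⟩ hn'
  · cases hv
    cases hv'
    rfl

theorem ValidState.postInstall (h : ValidState P s) {app : V.AppId} {m : Manifest V} {c : V.Cert}
    {lRes : List V.Res} {s' : AndroidST V} (hpre : Pre P s (.install app m c lRes))
    (hpost : Post P s (.install app m c lRes) s') : ValidState P s' := by
  obtain ⟨hnew, hdupC, hcmp, hdupP, hauth, -⟩ := hpre
  obtain ⟨hm, hc, hd, ha, hr, ⟨hps, hgr⟩, hrun, hdelP, hdelT, hint, hsys⟩ := hpost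
  have hinst : app ∉ s.instApps := fun hin => hnew (Or.inl hin)
  have inApp_iff := @inApp_install V s app m s' (h.manifestsDom ▸ hinst) hm hsys
  have defines_iff := @definesPerm_install V P s app m s' (h.appDefPSDom ▸ hinst) hd hsys
  have inst_iff := @isAppInstalled_install V s app s' ha hsys
  have inApp_mono : ∀ {c}, (∃ a, InApp c a s) → ∃ a, InApp c a s' :=
    fun ⟨a, hin⟩ => ⟨a, inApp_iff.2 (Or.inl hin)⟩
  have hdom : insert app {a | IsAppInstalled a s} = {a | IsAppInstalled a s'} :=
    Set.ext fun _ => inst_iff.symm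
  unfold AddManifest at hm
  unfold AddCert at hc
  unfold AddDefPerms at hd
  unfold AddApp at ha
  exact {
    cmpDifferent := by
      intro c₁ c₂ a₁ a₂ h₁ h₂ hid
      rcases inApp_iff.1 h₁ with h₁ | ⟨-, h₁⟩ <;> rcases inApp_iff.1 h₂ with h₂ | ⟨-, h₂⟩
      · exact h.cmpDifferent c₁ c₂ a₁ a₂ h₁ h₂ hid
      · exact absurd ⟨c₁, a₁, h₁, hid⟩ (hcmp c₂ h₂)
      · exact absurd ⟨c₂, a₂, h₂, hid.symm⟩ (hcmp c₁ h₁)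
      · by_contra hne
        exact hdupC ⟨c₁, h₁, c₂, h₂, hne, hid⟩
    notRepeatedCmps := by
      intro c₁ a₁ a₂ h₁ h₂
      rcases inApp_iff.1 h₁ with h₁ | ⟨e₁, h₁⟩ <;> rcases inApp_iff.1 h₂ with h₂ | ⟨e₂, h₂⟩
      · exact h.notRepeatedCmps c₁ a₁ a₂ h₁ h₂
      · exact absurd ⟨c₁, a₁, h₁, rfl⟩ (hcmp c₁ h₂)
      · exact absurd ⟨c₁, a₂, h₂, rfl⟩ (hcmp c₁ h₁)
      · exact e₁.trans e₂.symm
    notProviderRunning := hrun ▸ h.notProviderRunning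
    delTmpRun := by
      intro ic cp u pt hx
      rw [hdelT] at hx
      rw [hrun]
      exact (h.delTmpRun ic cp u pt hx).imp_right inApp_mono
    cmpRunAppIns := by
      intro ic c₁ hc₁
      rw [hrun] at hc₁
      exact inApp_mono (h.cmpRunAppIns ic c₁ hc₁)
    resAppIns := by
      intro a r v hx
      rw [hr] at hx
      rcases hx with ⟨hx, -⟩ | ⟨q, -, hx⟩
      · exact inst_iff.2 (Or.inr (h.resAppIns a r v hx))
      · cases hx
        exact inst_iff.2 (Or.inl rfl)
    manifestsDom := by rw [hm, ha, Mapping.dom_add, h.manifestsDom]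
    certsDom := by rw [hc, ha, Mapping.dom_add, h.certsDom]
    appDefPSDom := by rw [hd, ha, Mapping.dom_add, h.appDefPSDom]
    appPSDom := by rw [hps, Mapping.dom_add, h.appPSDom, hdom]
    permsGrDom := by rw [hgr, Mapping.dom_add, h.permsGrDom, hdom]
    notDupApp := by
      intro a hin
      unfold IsSysApp
      rw [hsys]
      rw [ha] at hin
      rcases hin with rfl | hin
      · exact fun hs => hnew (Or.inr hs)
      · exact h.notDupApp a hin
    notDupSysApp := hsys ▸ h.notDupSysApp
    notDupPerm := by
      intro a₁ a₂ p₁ p₂ h₁ h₂ hid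
      rcases defines_iff.1 h₁ with h₁ | ⟨e₁, h₁⟩ <;> rcases defines_iff.1 h₂ with h₂ | ⟨e₂, h₂⟩
      · exact h.notDupPerm a₁ a₂ p₁ p₂ h₁ h₂ hid
      · exact absurd hid (hauth p₂ h₂.1 a₁ p₁ h₁)
      · exact absurd hid.symm (hauth p₁ h₁.1 a₂ p₂ h₂)
      · refine ⟨?_, e₁.trans e₂.symm⟩
        by_contra hne
        exact hdupP ⟨p₁, h₁.1, p₂, h₂.1, hne, hid⟩
    permsGrFun := hgr ▸ h.permsGrFun.add _ _
    appPSFun := hps ▸ h.appPSFun.add _ _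
    runningFun := hrun ▸ h.runningFun
    delPPermsFun := hdelP ▸ h.delPPermsFun
    delTPermsFun := hdelT ▸ h.delTPermsFun
    arvsFun := isFunctional_addRes h.arvsFun hr
    manifestsFun := hm ▸ h.manifestsFun.add _ _
    certsFun := hc ▸ h.certsFun.add _ _
    appDefPSFun := hd ▸ h.appDefPSFun.add _ _
    grantedPermsExist := by
      intro a l p hl hp
      rw [hps] at hl
      rcases hl with ⟨hl, -⟩ | hl
      · exact (h.grantedPermsExist a l p hl hp).imp_right
          fun ⟨b, hb⟩ => ⟨b, defines_iff.2 (Or.inl hb)⟩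
      · cases hl
        exact absurd hp (Set.notMem_empty p)
    notDupIntents := hint ▸ h.notDupIntents }

end

end Android

theorem lemma1 (V : Android.Vocabulary.{u}) (P : Android.Platform V)
    (s s' : Android.AndroidST V) (a : Android.Action V) (r : Android.Response)
    (h : Android.Step P s a r s') : Android.ValidState P s' := by
  cases h with
  | error hv _ => exact hv
  | ok hv hpre hpost =>
    cases a with
    | install app m c lRes => exact hv.postInstall hpre hpost
    | uninstall app => exact hv.postUninstall hpre.1 hpre.2 hpost
    | grant p app =>
      cases hpost
      refine hv.mapValues_appPS _ fun a l q hq => hq.imp_right ?_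
      rintro ⟨-, rfl⟩
      exact hpre.2.2.1
    | revoke p app =>
      cases hpost
      exact hv.mapValues_appPS _ fun a l q hq => Or.inl hq.1
    | grantPermGroup g app =>
      cases hpost
      exact hv.mapValues_permsGr _
    | revokePermGroup g app =>
      cases hpost
      exact hv.mapValues_permsGr _
    | hasPermission p app =>
      cases hpost
      exact hv
    | read ic cp uri =>
      cases hpost
      exact hv
    | write ic cp uri val => exact hv.postWrite hpost
    | startActivity i ic => exact hv.postSend hpre.2.2.2 hpost
    | startActivityRes i n ic => exact hv.postSend hpre.2.2.2 hpost
    | startService i ic => exact hv.postSend hpre.2.2.2 hpost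
    | sendBroadcast i ic p => exact hv.postSend hpre.2.2.2 hpost
    | sendOrdBroadcast i ic p => exact hv.postSend hpre.2.2.2 hpost
    | sendSBroadcast i ic => exact hv.postSend hpre.2.2.2 hpost
    | resolveIntent i app => exact hv.postResolve hpost
    | receiveIntent i ic app =>
      obtain ⟨-, ⟨c, _, ht, -⟩, -⟩ := hpre
      exact hv.postReceive ⟨c, ht⟩ hpost
    | stopInstance ic =>
      cases hpost
      exact hv.stopInstance ic
    | grantP ic cp app uri pt =>
      cases hpost
      exact hv.addDelegation_delPPerms _ pt
    | revokeDel ic cp uri pt =>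
      cases hpost
      exact hv.dropDelegations cp uri pt
    | call ic sac =>
      cases hpost
      exact hv
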